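/- Let $A,B,C$ be disjoint finite sets. A hypergraph is a set $H\subseteq A\times B\times C$ of hyperedges (a partite $3$-uniform hypergraph), and $\mathcal H$ is the set of all hypergraphs. The degree $d_H(v)$ of a vertex $v$ is the number of hyperedges of $H$ containing $v$. Let $d(v)\in\mathbb Z_{\ge 0}$ be prescribed degrees, for $v\in A\cup B\cup C$, and put $\Delta G(H)=\sum_{v\in A\cup B\cup C}|d(v)-d_H(v)|$. For $T>0$ let $\pi_T$ be the Boltzmann distribution on $\mathcal H$, $\pi_T(H)=\frac1Z e^{-\Delta G(H)/T}$ with $Z=\sum_{H\in\mathcal H}e^{-\Delta G(H)/T}$. A step of the Markov chain $M_T$ on $\mathcal H$ from $H$ is as follows. First a hypergraph $H'$ is proposed by one of three operations, each chosen with probability $\frac13$: 1. Switch: choose $e_1,e_2\in H$ independently and uniformly, and a vertex class $X\in\{A,B,C\}$ uniformly. Let $e_1',e_2'$ be obtained from $e_1,e_2$ by exchanging their vertices in $X$. If $e_1',e_2'\notin H$, then $H'=(H\cup\{e_1',e_2'\})\setminus\{e_1,e_2\}$. 2. Hinge-flip: choose $e\in H$, a class $X\in\{A,B,C\}$, and then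 a vertex $x\in X$, $x\notin e$, each uniformly. Let $e'$ be $e$ with its vertex in $X$ replaced by $x$. If $e'\notin H$, then $H'=(H\cup\{e'\})\setminus\{e\}$. 3. Toggle: choose $e\in A\times B\times C$ uniformly; $H'=H\setminus\{e\}$ if $e\in H$, and $H'=H\cup\{e\}$ otherwise. If the operation is not allowed, or a required choice is from an empty set, then $H'=H$. The next state is $H'$ if $u\le e^{-\Delta G(H')/T}/e^{-\Delta G(H)/T}$ for a random $u$ uniform on $[0,1]$, and $H$ otherwise. Let $k\ge1$ and $0<T_1<\dots<T_k$. The Parallel Tempering chain $\mathcal M$ on $\mathcal H^k$ makes the following step from $(H_1,\dots,H_k)$. With probability $\frac12$, choose $i\in\{1,\dots,k\}$ uniformly and make a step of $M_{T_i}$ in the $i$-th coordinate. With probability $\frac12$, choose $i\in\{1,\dots,k-1\}$ uniformly (if $k=1$, do nothing), draw $u$ uniformly from $[0,1]$, and exchange $H_i$ and $H_{i+1}$ if $$u\le\frac{e^{-\Delta G(H_i)/T_{i+1}}\,e^{-\Delta G(H_{i+1})/T_i}}{e^{-\Delta G(H_i)/T_i}\,e^{-\Delta G(H_{i+1})/T_{i+1}}};$$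 otherwise do nothing. **Theorem.** The chain $\mathcal M$ converges to $\pi_{T_1}\times\pi_{T_2}\times\dots\times\pi_{T_k}$: for every initial distribution on $\mathcal H^k$, the law of the state after $t$ steps converges to $\pi_{T_1}\times\dots\times\pi_{T_k}$ in total variation distance as $t\to\infty$. In this limit distribution the coordinates are independent, and the $i$-th coordinate has the distribution $\pi_{T_i}$. -/

import Mathlib

open MeasureTheory ProbabilityTheory Filter Topology

/-- A hyperedge of a partite 3-uniform hypergraph: exactly one vertex from each of the three
disjoint vertex classes `A`, `B`, `C`. -/
abbrev Hyperedge (A B C : Type*) := A × B × C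

/-- A partite 3-uniform hypergraph on the vertex classes `A`, `B`, `C`, given by its
set of hyperedges. -/
abbrev PartiteHypergraph (A B C : Type*) := Finset (Hyperedge A B C)

/-- A prescribed degree sequence `D = (D_A, D_B, D_C)` (not assumed to have a realization). -/
structure DegreeSequence (A B C : Type*) where
  dA : A → ℕ
  dB : B → ℕ
  dC : C → ℕ

section Energy

variable {A B C : Type*} [DecidableEq A] [DecidableEq B] [DecidableEq C]

/-- The degree of a vertex `a ∈ A`: the number of hyperedges incident with it. -/
def degA (H : PartiteHypergraph A B C) (a : A) : ℕ := (H.filter fun e => e.1 = a).card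

/-- The degree of a vertex `b ∈ B`. -/
def degB (H : PartiteHypergraph A B C) (b : B) : ℕ := (H.filter fun e => e.2.1 = b).card

/-- The degree of a vertex `c ∈ C`. -/
def degC (H : PartiteHypergraph A B C) (c : C) : ℕ := (H.filter fun e => e.2.2 = c).card

variable [Fintype A] [Fintype B] [Fintype C]

/-- The energy `ΔG(H)`: the `L¹` deviation of the degrees of `H` from the prescribed ones. -/
noncomputable def energy (D : DegreeSequence A B C) (H : PartiteHypergraph A B C) : ℝ :=
  ∑ a, |(D.dA a : ℝ) - degA H a| + ∑ b, |(D.dB b : ℝ) - degB H b|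
    + ∑ c, |(D.dC c : ℝ) - degC H c|

/-- The Boltzmann weight `exp (-ΔG(H) / T)`. -/
noncomputable def boltzmannWeight (D : DegreeSequence A B C) (T : ℝ) (H : PartiteHypergraph A B C) : ℝ :=
  Real.exp (-energy D H / T)

/-- The partition function `Z`. -/
noncomputable def partitionFunction (D : DegreeSequence A B C) (T : ℝ) : ℝ :=
  ∑ H : PartiteHypergraph A B C, boltzmannWeight D T H

theorem boltzmannWeight_pos (D : DegreeSequence A B C) (T : ℝ) (H : PartiteHypergraph A B C) :
    0 < boltzmannWeight D T H := Real.exp_pos _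

theorem partitionFunction_pos (D : DegreeSequence A B C) (T : ℝ) :
    0 < partitionFunction D T :=
  Finset.sum_pos (fun H _ => boltzmannWeight_pos D T H) Finset.univ_nonempty

/-- The Boltzmann distribution `π_T(H) = exp (-ΔG(H) / T) / Z` on the set of all hypergraphs. -/
noncomputable def boltzmann (D : DegreeSequence A B C) (T : ℝ) : PMF (PartiteHypergraph A B C) :=
  PMF.ofFintype (fun H => ENNReal.ofReal (boltzmannWeight D T H / partitionFunction D T)) (by
    rw [← ENNReal.ofReal_sum_of_nonneg
      (fun H _ => div_nonneg (boltzmannWeight_pos D T H).le (partitionFunction_pos D T).le),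
      ← Finset.sum_div]
    exact (congrArg ENNReal.ofReal (div_self (partitionFunction_pos D T).ne')).trans
      ENNReal.ofReal_one)

/-- The product distribution `π_{T_1} × ⋯ × π_{T_k}` on tuples of hypergraphs. -/
noncomputable def boltzmannProduct {k : ℕ} (D : DegreeSequence A B C) (T : Fin k → ℝ) :
    PMF (Fin k → PartiteHypergraph A B C) :=
  PMF.ofFintype (fun s => ∏ i, boltzmann D (T i) (s i)) (by
    rw [← Fintype.prod_sum]
    refine Finset.prod_eq_one fun i _ => ?_
    exact (tsum_fintype _).symm.trans (boltzmann D (T i)).tsum_coe)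

end Energy

section Random

/-- Draw `x` uniformly from the finite set `s` and continue with `f x`; if there is nothing to
choose from, the outcome is `y`. -/
noncomputable def drawOr {α β : Type*} (s : Finset α) (y : β) (f : α → PMF β) : PMF β :=
  open Classical in
  if h : s.Nonempty then (PMF.uniformOfFinset s h).bind f else PMF.pure y

/-- The uniform distribution on the interval `[0, 1]`. -/
noncomputable def uniformUnitInterval : Measure ℝ := volume.restrict (Set.Icc 0 1)

/-- The probability that `u ≤ r` for a random number `u` uniform on `[0, 1]`. -/
noncomputable def acceptProb (r : ℝ) : ENNReal := uniformUnitInterval (Set.Iic r)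

theorem acceptProb_le_one (r : ℝ) : acceptProb r ≤ 1 := by
  unfold acceptProb uniformUnitInterval
  refine (measure_mono (Set.subset_univ _)).trans ?_
  simp

/-- Draw `u` uniformly from `[0, 1]`; the outcome is `x` if `u ≤ r`, and `y` otherwise. -/
noncomputable def acceptOr {β : Type*} (r : ℝ) (x y : β) : PMF β :=
  (PMF.ofFintype (fun b : Bool => if b then acceptProb r else 1 - acceptProb r) (by
    simpa using add_tsub_cancel_of_le (acceptProb_le_one r))).map fun b => if b then x else y

/-- The total variation distance of two distributions on a finite set. -/
noncomputable def tvDist {α : Type*} [Fintype α] (μ ν : PMF α) : ℝ :=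
  (1 / 2) * ∑ x, |(μ x).toReal - (ν x).toReal|

end Random

section Chain

variable {A B C : Type*} [DecidableEq A] [DecidableEq B] [DecidableEq C]

/-- The names of the three vertex classes. -/
inductive VertexClass
  | A | B | C
  deriving DecidableEq

instance VertexClass.instFintype : Fintype VertexClass where
  elems := {.A, .B, .C}
  complete := by rintro (_ | _ | _) <;> decide

/-- The hyperedge obtained from `e` by replacing its vertex in the class `X` by that of `e'`. -/
def replaceVertex (X : VertexClass) (e e' : Hyperedge A B C) : Hyperedge A B C :=
  match X with
  | .A => (e'.1, e.2.1, e.2.2)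
  | .B => (e.1, e'.2.1, e.2.2)
  | .C => (e.1, e.2.1, e'.2.2)

/-- The outcome of a switch at `e₁`, `e₂` and the class `X`, which exchanges the vertices of
`e₁` and `e₂` in `X`; nothing happens if one of the new hyperedges is already present. -/
def switchAt (H : PartiteHypergraph A B C) (e₁ e₂ : Hyperedge A B C) (X : VertexClass) :
    PartiteHypergraph A B C :=
  if replaceVertex X e₁ e₂ ∉ H ∧ replaceVertex X e₂ e₁ ∉ H then
    (H ∪ {replaceVertex X e₁ e₂, replaceVertex X e₂ e₁}) \ {e₁, e₂}
  else H

/-- The outcome of a hinge-flip that replaces the hyperedge `e` by `e'`; nothing happens if `e'`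
is already present. -/
def hingeFlipAt (H : PartiteHypergraph A B C) (e e' : Hyperedge A B C) : PartiteHypergraph A B C :=
  if e' ∉ H then (H ∪ {e'}) \ {e} else H

/-- Toggle the hyperedge `e` out if it is present, and in if it is not. -/
def toggleAt (H : PartiteHypergraph A B C) (e : Hyperedge A B C) : PartiteHypergraph A B C :=
  if e ∈ H then H \ {e} else H ∪ {e}

/-- The switch proposal: two hyperedges chosen independently and uniformly, and a uniform
vertex class. -/
noncomputable def switchProposal (H : PartiteHypergraph A B C) : PMF (PartiteHypergraph A B C) :=
  drawOr H H fun e₁ => drawOr H H fun e₂ => drawOr (Finset.univ : Finset VertexClass) H fun X =>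
    PMF.pure (switchAt H e₁ e₂ X)

variable [Fintype A] [Fintype B] [Fintype C]

/-- The hinge-flip proposal: a uniform hyperedge `e`, a uniform vertex class `X`, and a uniform
vertex `x` of that class with `x ∉ e`. -/
noncomputable def hingeFlipProposal (H : PartiteHypergraph A B C) : PMF (PartiteHypergraph A B C) :=
  drawOr H H fun e => drawOr (Finset.univ : Finset VertexClass) H fun X =>
    match X with
    | .A => drawOr (Finset.univ.filter fun x : A => x ≠ e.1) H fun x =>
        PMF.pure (hingeFlipAt H e (x, e.2.1, e.2.2))
    | .B => drawOr (Finset.univ.filter fun x : B => x ≠ e.2.1) H fun x =>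
        PMF.pure (hingeFlipAt H e (e.1, x, e.2.2))
    | .C => drawOr (Finset.univ.filter fun x : C => x ≠ e.2.2) H fun x =>
        PMF.pure (hingeFlipAt H e (e.1, e.2.1, x))

/-- The toggle proposal: a uniform triple of vertices, one of each class. -/
noncomputable def toggleProposal (H : PartiteHypergraph A B C) : PMF (PartiteHypergraph A B C) :=
  drawOr (Finset.univ : Finset (Hyperedge A B C)) H fun e => PMF.pure (toggleAt H e)

/-- The proposal of the chains: switch, hinge-flip or toggle, each with probability `1/3`. -/
noncomputable def proposal (H : PartiteHypergraph A B C) : PMF (PartiteHypergraph A B C) :=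
  (PMF.uniformOfFintype (Fin 3)).bind fun j =>
    match j with
    | 0 => switchProposal H
    | 1 => hingeFlipProposal H
    | 2 => toggleProposal H

/-- One step of the Metropolis-Hastings chain `M_T` from the state `H`. -/
noncomputable def metropolisStep (D : DegreeSequence A B C) (T : ℝ) (H : PartiteHypergraph A B C) :
    PMF (PartiteHypergraph A B C) :=
  (proposal H).bind fun H' => acceptOr (boltzmannWeight D T H' / boltzmannWeight D T H) H' H

/-- The swap proposal's ratio for two states `H`, `H'` at the temperatures `T`, `T'`. -/
noncomputable def swapRatio (D : DegreeSequence A B C) (T T' : ℝ) (H H' : PartiteHypergraph A B C) : ℝ :=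
  (boltzmannWeight D T' H * boltzmannWeight D T H') /
    (boltzmannWeight D T H * boltzmannWeight D T' H')

/-- One step of the Parallel Tempering chain on `k = n + 1` hypergraphs at the temperatures
`T 0, …, T n`. With probability `1/2` a uniformly chosen coordinate makes a Metropolis-Hastings
step, and with probability `1/2` a swap of the states of a uniformly chosen pair of
neighbouring coordinates `i`, `i + 1` is attempted (if there is such a pair). -/
noncomputable def parallelTemperingStep {n : ℕ} (D : DegreeSequence A B C)
    (T : Fin (n + 1) → ℝ) (s : Fin (n + 1) → PartiteHypergraph A B C) :
    PMF (Fin (n + 1) → PartiteHypergraph A B C) :=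
  (PMF.uniformOfFintype Bool).bind fun b =>
    if b then
      drawOr (Finset.univ : Finset (Fin (n + 1))) s fun i =>
        (metropolisStep D (T i) (s i)).map fun H => Function.update s i H
    else
      drawOr (Finset.univ : Finset (Fin n)) s fun i =>
        acceptOr (swapRatio D (T i.castSucc) (T i.succ) (s i.castSucc) (s i.succ))
          (s ∘ Equiv.swap i.castSucc i.succ) s

/-- The law of the Parallel Tempering chain after `t` steps, for the initial distribution `μ`. -/
noncomputable def parallelTemperingLaw {n : ℕ} (D : DegreeSequence A B C)
    (T : Fin (n + 1) → ℝ) (μ : PMF (Fin (n + 1) → PartiteHypergraph A B C)) (t : ℕ) :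
    PMF (Fin (n + 1) → PartiteHypergraph A B C) :=
  (fun ν => ν.bind (parallelTemperingStep D T))^[t] μ

end Chain

/-! Stationarity comes from detailed balance, convergence from a Doeblin argument. Switches and
hinge-flips preserve the number of hyperedges, and every successful move is undone by a move of the
same type. The proposal is therefore symmetric off the diagonal (`proposal_comm`), and its
Metropolis filter is reversible for the Boltzmann weight. An exchange of neighbouring coordinates is
itself a Metropolis move for the product weight (`swapRatio_eq`). So the whole step is reversible
for the product weight and fixes the product distribution (`boltzmannProduct_bind_step`). Toggling
out hyperedges one at a time leads from any state to the tuple of empty hypergraphs, where the chain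
can wait. Hence at one common time this tuple has positive probability from every start, and total
variation distance contracts (`tendsto_tvDist_iterate`). A common reachable state takes the place of
irreducibility and aperiodicity. -/

section FiniteChain

/-! ### Convergence of finite Markov chains -/

variable {α : Type*}

/-- Running `t` steps is linear in the initial law, so it is again a kernel, to which the
contraction estimate applies. -/
theorem PMF.iterate_bind_eq_bind (K : α → PMF α) (t : ℕ) (μ : PMF α) :
    (fun ν : PMF α => ν.bind K)^[t] μ =
      μ.bind fun x => (fun ν : PMF α => ν.bind K)^[t] (PMF.pure x) := by
  induction t generalizing μ with
  | zero => simp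
  | succ t ih =>
    simp only [Function.iterate_succ_apply, PMF.pure_bind]
    rw [ih, PMF.bind_bind]
    congr 1
    funext x
    exact (ih (K x)).symm

/-- `m` bounds the number of steps needed to reach `x₀`. Since `x₀` can be held, early arrivals wait
there, and one time `t` serves all starting points with `m x ≤ t`. -/
theorem PMF.iterate_bind_ne_zero (K : α → PMF α) (x₀ : α) (m : α → ℕ) (hm₀ : m x₀ = 0)
    (h₀ : K x₀ x₀ ≠ 0)
    (hm : ∀ x, x ≠ x₀ → ∃ y, m y < m x ∧ K x y ≠ 0) (t : ℕ) (x : α) (hx : m x ≤ t) :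
    (fun ν : PMF α => ν.bind K)^[t] (PMF.pure x) x₀ ≠ 0 := by
  induction t generalizing x with
  | zero =>
    by_cases h : x = x₀
    · simp [h]
    · obtain ⟨y, hy, -⟩ := hm x h
      omega
  | succ t ih =>
    have step : ∀ y, K x y ≠ 0 → m y ≤ t →
        (fun ν : PMF α => ν.bind K)^[t + 1] (PMF.pure x) x₀ ≠ 0 := by
      intro y hy hyt
      rw [Function.iterate_succ_apply, PMF.pure_bind, PMF.iterate_bind_eq_bind,
        ← PMF.mem_support_iff, PMF.mem_support_bind_iff]
      exact ⟨y, hy, ih y hyt⟩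
    by_cases h : x = x₀
    · subst h
      exact step x h₀ (by omega)
    · obtain ⟨y, hy, hKy⟩ := hm x h
      exact step y hKy (by omega)

variable [Fintype α]

theorem PMF.sum_toReal_eq_one (μ : PMF α) : ∑ x, (μ x).toReal = 1 := by
  rw [← ENNReal.toReal_sum fun x _ => μ.apply_ne_top x,
    (tsum_fintype _).symm.trans μ.tsum_coe, ENNReal.toReal_one]

theorem PMF.toReal_bind_apply (μ : PMF α) (L : α → PMF α) (y : α) :
    (μ.bind L y).toReal = ∑ x, (μ x).toReal * (L x y).toReal := by
  rw [PMF.bind_apply, tsum_fintype, ENNReal.toReal_sum fun x _ =>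
    ENNReal.mul_ne_top (μ.apply_ne_top x) ((L x).apply_ne_top y)]
  simp

theorem tvDist_nonneg (μ ν : PMF α) : 0 ≤ tvDist μ ν :=
  mul_nonneg (by norm_num) (Finset.sum_nonneg fun _ _ => abs_nonneg _)

/-- Doeblin contraction: a kernel that charges a common point with mass at least `c` contracts the
total variation distance by the factor `1 - c`. -/
theorem tvDist_bind_le (L : α → PMF α) (x₀ : α) {c : ℝ} (hc : ∀ x, c ≤ (L x x₀).toReal)
    (μ ν : PMF α) : tvDist (μ.bind L) (ν.bind L) ≤ (1 - c) * tvDist μ ν := by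
  classical
  -- Removing the common mass `c` at `x₀` from every row leaves a nonnegative kernel with row sums
  -- `1 - c`.
  set r : α → α → ℝ := fun x y => (L x y).toReal - if y = x₀ then c else 0 with hr
  have hr0 : ∀ x y, 0 ≤ r x y := by
    intro x y
    by_cases h : y = x₀
    · simpa [hr, h] using hc x
    · simp [hr, h]
  have hrs : ∀ x, ∑ y, r x y = 1 - c := by
    intro x
    simp [hr, Finset.sum_sub_distrib, PMF.sum_toReal_eq_one]
  have hzero : ∑ x, ((μ x).toReal - (ν x).toReal) = 0 := by
    rw [Finset.sum_sub_distrib, PMF.sum_toReal_eq_one, PMF.sum_toReal_eq_one, sub_self]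
  -- The removed part does not depend on `x`, so it cancels against a difference of total mass zero.
  have key : ∀ y, (μ.bind L y).toReal - (ν.bind L y).toReal =
      ∑ x, ((μ x).toReal - (ν x).toReal) * r x y := by
    intro y
    simp only [hr, mul_sub, Finset.sum_sub_distrib, ← Finset.sum_mul, hzero, zero_mul, sub_zero]
    simp only [sub_mul, Finset.sum_sub_distrib, PMF.toReal_bind_apply]
  have : ∑ y, |(μ.bind L y).toReal - (ν.bind L y).toReal| ≤
      (1 - c) * ∑ x, |(μ x).toReal - (ν x).toReal| := by
    calc ∑ y, |(μ.bind L y).toReal - (ν.bind L y).toReal|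
        ≤ ∑ y, ∑ x, |(μ x).toReal - (ν x).toReal| * r x y := by
          refine Finset.sum_le_sum fun y _ => ?_
          rw [key]
          refine (Finset.abs_sum_le_sum_abs _ _).trans_eq (Finset.sum_congr rfl fun x _ => ?_)
          rw [abs_mul, abs_of_nonneg (hr0 x y)]
      _ = (1 - c) * ∑ x, |(μ x).toReal - (ν x).toReal| := by
          rw [Finset.sum_comm]
          simp only [← Finset.mul_sum, hrs]
          rw [← Finset.sum_mul, mul_comm]
  unfold tvDist
  linarith

/-- A finite chain with a stationary distribution `π` that reaches the state `x₀` from every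
initial state with positive probability at a common time converges to `π`. -/
theorem tendsto_tvDist_iterate (K : α → PMF α) (π : PMF α) (hπ : π.bind K = π) (x₀ : α) (N : ℕ)
    (hN : ∀ x, (fun ν : PMF α => ν.bind K)^[N] (PMF.pure x) x₀ ≠ 0) (μ : PMF α) :
    Tendsto (fun t => tvDist ((fun ν : PMF α => ν.bind K)^[t] μ) π) atTop (𝓝 0) := by
  set F : PMF α → PMF α := fun ν => ν.bind K with hF
  set a : ℕ → ℝ := fun t => tvDist (F^[t] μ) π with ha
  have hfix : ∀ t, F^[t] π = π := fun t => Function.iterate_fixed hπ t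
  have hanti : Antitone a := by
    refine antitone_nat_of_succ_le fun t => ?_
    -- With `c = 0` the estimate says that one step never increases the distance.
    have := tvDist_bind_le K x₀ (c := 0) (fun _ => ENNReal.toReal_nonneg) (F^[t] μ) π
    rw [hπ, sub_zero, one_mul] at this
    simpa only [ha, Function.iterate_succ_apply'] using this
  obtain ⟨x₁, -, hx₁⟩ := Finset.exists_min_image Finset.univ
    (fun x => (F^[N] (PMF.pure x) x₀).toReal) ⟨x₀, Finset.mem_univ _⟩
  set c := (F^[N] (PMF.pure x₁) x₀).toReal with hc
  have hcpos : 0 < c := ENNReal.toReal_pos (hN x₁) (PMF.apply_ne_top _ _)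
  have hcontr : ∀ t, a (t + N) ≤ (1 - c) * a t := by
    intro t
    have := tvDist_bind_le (fun x => F^[N] (PMF.pure x)) x₀ (fun x => hx₁ x (Finset.mem_univ x))
      (F^[t] μ) π
    rw [← PMF.iterate_bind_eq_bind, ← PMF.iterate_bind_eq_bind, ← hF, hfix,
      ← Function.iterate_add_apply, add_comm] at this
    exact this
  have hbdd : BddBelow (Set.range a) := ⟨0, by rintro _ ⟨t, rfl⟩; exact tvDist_nonneg _ _⟩
  have hlim := tendsto_atTop_ciInf hanti hbdd
  have h0 : 0 ≤ ⨅ t, a t := le_ciInf fun t => tvDist_nonneg _ _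
  -- The limit `L` satisfies `0 ≤ L ≤ (1 - c) * L` with `c > 0`, hence vanishes.
  have h1 : ⨅ t, a t ≤ (1 - c) * ⨅ t, a t :=
    le_of_tendsto_of_tendsto' (hlim.comp (tendsto_add_atTop_nat N)) (hlim.const_mul _) hcontr
  have : ⨅ t, a t = 0 := by nlinarith
  rwa [this] at hlim

end FiniteChain

/-! ### Detailed balance and its closure properties -/

section Reversible

variable {α ι : Type*}

/-- Detailed balance of a Markov kernel with respect to the weights `w`. -/
def DetailedBalance (K : α → PMF α) (w : α → ENNReal) : Prop :=
  ∀ x y, w x * K x y = w y * K y x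

/-- The diagonal case is trivial, so rejection probabilities never have to be computed. -/
theorem detailedBalance_of_ne {K : α → PMF α} {w : α → ENNReal}
    (h : ∀ x y, y ≠ x → w x * K x y = w y * K y x) : DetailedBalance K w := by
  intro x y
  by_cases hxy : y = x
  · rw [hxy]
  · exact h x y hxy

theorem DetailedBalance.bind_eq {K : α → PMF α} {π : PMF α} (h : DetailedBalance K π) :
    π.bind K = π := by
  ext y
  rw [PMF.bind_apply]
  simp only [fun x => h x y, ENNReal.tsum_mul_left, PMF.tsum_coe, mul_one]

theorem DetailedBalance.const_mul {K : α → PMF α} {w : α → ENNReal} (h : DetailedBalance K w)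
    (c : ENNReal) : DetailedBalance K fun x => c * w x := by
  intro x y
  simp only [mul_assoc, h x y]

theorem detailedBalance_pure (w : α → ENNReal) : DetailedBalance PMF.pure w := by
  refine detailedBalance_of_ne fun x y hxy => ?_
  rw [PMF.pure_apply_of_ne _ _ hxy, PMF.pure_apply_of_ne _ _ hxy.symm, mul_zero, mul_zero]

/-- Detailed balance is linear in the kernel, and the mixing law `p` does not depend on the state.
-/
theorem detailedBalance_bind (p : PMF ι) {K : ι → α → PMF α} {w : α → ENNReal}
    (h : ∀ i, DetailedBalance (K i) w) : DetailedBalance (fun x => p.bind fun i => K i x) w := by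
  intro x y
  simp only [PMF.bind_apply, ← ENNReal.tsum_mul_left]
  refine tsum_congr fun i => ?_
  rw [mul_left_comm, h i x y, mul_left_comm]

theorem detailedBalance_drawOr (s : Finset ι) {K : ι → α → PMF α} {w : α → ENNReal}
    (h : ∀ i, DetailedBalance (K i) w) :
    DetailedBalance (fun x => drawOr s x fun i => K i x) w := by
  by_cases hs : s.Nonempty
  · simpa only [drawOr, hs, dite_true] using detailedBalance_bind _ h
  · simpa only [drawOr, hs, dite_false] using detailedBalance_pure w

theorem acceptProb_eq (r : ℝ) : acceptProb r = ENNReal.ofReal (min 1 r) := by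
  rw [acceptProb, uniformUnitInterval, Measure.restrict_apply measurableSet_Iic]
  have : Set.Iic r ∩ Set.Icc 0 1 = Set.Icc 0 (min 1 r) := by
    ext u
    simp only [Set.mem_inter_iff, Set.mem_Iic, Set.mem_Icc, le_min_iff]
    tauto
  rw [this, Real.volume_Icc, sub_zero]

theorem acceptOr_apply_of_ne (r : ℝ) {x y z : α} (hz : z ≠ y) :
    acceptOr r x y z = acceptProb r * PMF.pure x z := by
  classical
  rw [acceptOr, PMF.map_apply, tsum_fintype, Fintype.sum_bool]
  simp [hz, PMF.pure_apply]

theorem bind_acceptOr_apply_of_ne (q : PMF α) (r : α → ℝ) {x y : α} (hxy : y ≠ x) :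
    (q.bind fun z => acceptOr (r z) z x) y = q y * acceptProb (r y) := by
  classical
  rw [PMF.bind_apply, tsum_eq_single y]
  · rw [acceptOr_apply_of_ne _ hxy, PMF.pure_apply_self, mul_one]
  · intro z hz
    rw [acceptOr_apply_of_ne _ hxy, PMF.pure_apply_of_ne _ _ hz.symm, mul_zero, mul_zero]

/-- The Metropolis filter of a symmetric proposal satisfies detailed balance. -/
theorem detailedBalance_metropolis (q : α → PMF α) (W : α → ℝ) (hW : ∀ x, 0 < W x)
    (hq : ∀ x y, y ≠ x → q x y = q y x) :
    DetailedBalance (fun x => (q x).bind fun y => acceptOr (W y / W x) y x)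
      fun x => ENNReal.ofReal (W x) := by
  -- Weight times acceptance probability is `min (W x) (W y)`, which is symmetric in `x` and `y`.
  have key : ∀ x y, ENNReal.ofReal (W x) * acceptProb (W y / W x) =
      ENNReal.ofReal (min (W x) (W y)) := by
    intro x y
    rw [acceptProb_eq, ← ENNReal.ofReal_mul (hW x).le,
      mul_min_of_nonneg _ _ (hW x).le, mul_one, mul_div_cancel₀ _ (hW x).ne']
  refine detailedBalance_of_ne fun x y hxy => ?_
  rw [bind_acceptOr_apply_of_ne _ _ hxy, bind_acceptOr_apply_of_ne _ _ hxy.symm,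
    mul_left_comm, key, mul_left_comm, key, hq x y hxy, min_comm]

theorem PMF.map_update_apply [DecidableEq ι] (p : PMF α) (s s' : ι → α) (i : ι) :
    (p.map fun b => Function.update s i b) s' =
      p (s' i) * PMF.pure (Function.update s i (s' i)) s' := by
  classical
  rw [PMF.map_apply, tsum_eq_single (s' i)]
  · simp [PMF.pure_apply]
  · intro b hb
    rw [if_neg]
    intro h
    apply hb
    rw [h, Function.update_self]

/-- The factors at `j ≠ i` are untouched by the move; if `s` and `s'` differ outside `i`, both sides
are zero. -/
theorem detailedBalance_update [Fintype ι] [DecidableEq ι] {K : α → PMF α} (w : ι → α → ENNReal)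
    (i : ι) (h : DetailedBalance K (w i)) :
    DetailedBalance (fun s : ι → α => (K (s i)).map fun b => Function.update s i b)
      fun s => ∏ j, w j (s j) := by
  classical
  intro s s'
  have split : ∀ s : ι → α,
      ∏ j, w j (s j) = w i (s i) * ∏ j ∈ Finset.univ.erase i, w j (s j) :=
    fun s => (Finset.mul_prod_erase _ _ (Finset.mem_univ i)).symm
  simp only [PMF.map_update_apply, split]
  by_cases hs : ∀ j, j ≠ i → s j = s' j
  · have h1 : Function.update s i (s' i) = s' := by
      ext1 j
      by_cases hj : j = i
      · subst hj; simp
      · simp [hj, hs j hj]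
    have h2 : Function.update s' i (s i) = s := by
      ext1 j
      by_cases hj : j = i
      · subst hj; simp
      · simp [hj, hs j hj]
    rw [h1, h2, PMF.pure_apply_self, PMF.pure_apply_self, mul_one, mul_one,
      mul_right_comm, h (s i) (s' i), mul_right_comm]
    congr 2
    exact Finset.prod_congr rfl fun j hj => by rw [hs j (Finset.ne_of_mem_erase hj)]
  · have h1 : s' ≠ Function.update s i (s' i) := fun h1 => hs fun j hj => by
      rw [h1, Function.update_of_ne hj]
    have h2 : s ≠ Function.update s' i (s i) := fun h2 => hs fun j hj => by
      rw [h2, Function.update_of_ne hj]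
    rw [PMF.pure_apply_of_ne _ _ h1, PMF.pure_apply_of_ne _ _ h2]
    simp

theorem drawOr_apply_of_ne (s : Finset ι) (f : ι → PMF α) {x y : α} (hxy : y ≠ x) :
    drawOr s x f y = (s.card : ENNReal)⁻¹ * ∑ i ∈ s, f i y := by
  classical
  by_cases hs : s.Nonempty
  · simp only [drawOr, hs, dite_true, PMF.bind_apply, PMF.uniformOfFinset_apply, ite_mul, zero_mul]
    rw [tsum_eq_sum (s := s) fun i hi => if_neg hi, Finset.mul_sum]
    exact Finset.sum_congr rfl fun i hi => if_pos hi
  -- For empty `s` the right side is `⊤ * 0 = 0`, matching the default outcome `x ≠ y`.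
  · simp only [drawOr, hs, dite_false]
    rw [PMF.pure_apply_of_ne _ _ hxy, Finset.not_nonempty_iff_eq_empty.mp hs]
    simp

theorem drawOr_apply_ne_zero {s : Finset ι} {i : ι} (hi : i ∈ s) (x : α) {f : ι → PMF α} {y : α}
    (h : f i y ≠ 0) : drawOr s x f y ≠ 0 := by
  have hs : s.Nonempty := ⟨i, hi⟩
  simp only [drawOr, hs, dite_true]
  rw [← PMF.mem_support_iff, PMF.mem_support_bind_iff]
  exact ⟨i, by simpa using hi, h⟩

/-- Two families of deterministic moves whose successful moves are matched by an involution
connect their states with the same frequency. -/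
theorem sum_pure_apply_eq (s t : Finset ι) (f g : ι → α) (x y : α) (σ : ι → ι)
    (hσ : Function.Involutive σ)
    (hs : ∀ i ∈ s, f i = y → σ i ∈ t ∧ g (σ i) = x)
    (ht : ∀ i ∈ t, g i = x → σ i ∈ s ∧ f (σ i) = y) :
    ∑ i ∈ s, PMF.pure (f i) y = ∑ i ∈ t, PMF.pure (g i) x := by
  classical
  simp only [PMF.pure_apply]
  rw [← Finset.sum_filter, ← Finset.sum_filter]
  refine Finset.sum_nbij' σ σ ?_ ?_ (fun i _ => hσ i) (fun i _ => hσ i) fun _ _ => rfl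
  · intro i hi
    obtain ⟨h1, h2⟩ := hs i (Finset.mem_filter.mp hi).1 (Finset.mem_filter.mp hi).2.symm
    exact Finset.mem_filter.mpr ⟨h1, h2.symm⟩
  · intro i hi
    obtain ⟨h1, h2⟩ := ht i (Finset.mem_filter.mp hi).1 (Finset.mem_filter.mp hi).2.symm
    exact Finset.mem_filter.mpr ⟨h1, h2.symm⟩

end Reversible

/-! ### Symmetry of the three proposals -/

section ProposalSymmetry

theorem drawOr_apply_eq_zero {α ι : Type*} {s : Finset ι} {f : ι → PMF α} {x y : α} (hxy : y ≠ x)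
    (h : ∀ i ∈ s, f i y = 0) : drawOr s x f y = 0 := by
  rw [drawOr_apply_of_ne s f hxy, Finset.sum_eq_zero h, mul_zero]

theorem VertexClass.sum_univ {M : Type*} [AddCommMonoid M] (f : VertexClass → M) :
    ∑ X, f X = f .A + f .B + f .C := by
  have : (Finset.univ : Finset VertexClass) = {.A, .B, .C} := rfl
  rw [this, Finset.sum_insert (by decide), Finset.sum_insert (by decide), Finset.sum_singleton,
    add_assoc]

variable {A B C : Type*}

theorem replaceVertex_replaceVertex (X : VertexClass) (e₁ e₂ : Hyperedge A B C) :
    replaceVertex X (replaceVertex X e₁ e₂) (replaceVertex X e₂ e₁) = e₁ := by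
  cases X <;> rfl

theorem replaceVertex_self (X : VertexClass) (e : Hyperedge A B C) :
    replaceVertex X e e = e := by
  cases X <;> rfl

variable [DecidableEq A] [DecidableEq B] [DecidableEq C]

/-- A switch that changes `H` is undone by switching the new hyperedges in the same class. The
equality of sizes makes the uniform draws from `H` and `H'` equally likely. -/
theorem switchAt_spec {H H' : PartiteHypergraph A B C} {e₁ e₂ : Hyperedge A B C}
    {X : VertexClass} (h₁ : e₁ ∈ H) (h₂ : e₂ ∈ H) (hne : H' ≠ H) (h : switchAt H e₁ e₂ X = H') :
    replaceVertex X e₁ e₂ ∈ H' ∧ replaceVertex X e₂ e₁ ∈ H' ∧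
      switchAt H' (replaceVertex X e₁ e₂) (replaceVertex X e₂ e₁) X = H ∧ H.card = H'.card := by
  unfold switchAt at h
  split_ifs at h with hif
  swap
  · exact absurd h.symm hne
  have i₁ := replaceVertex_replaceVertex X e₁ e₂
  have i₂ := replaceVertex_replaceVertex X e₂ e₁
  have hself := replaceVertex_self X e₁
  unfold switchAt
  rw [i₁, i₂]
  generalize hf₁ : replaceVertex X e₁ e₂ = f₁ at *
  generalize hf₂ : replaceVertex X e₂ e₁ = f₂ at *
  obtain ⟨hn₁, hn₂⟩ := hif
  -- Exchanging a vertex of `e₁` with itself returns `e₁`, which is present, so the switch would be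
  -- forbidden.
  have he : e₁ ≠ e₂ := by
    rintro rfl
    exact hn₁ (by rwa [← hf₁, hself])
  have hf : f₁ ≠ f₂ := by
    rintro rfl
    exact he (i₁.symm.trans i₂)
  have hcard : H'.card = H.card := by
    rw [← h, Finset.card_sdiff_of_subset, Finset.card_union_of_disjoint, Finset.card_pair he,
      Finset.card_pair hf, Nat.add_sub_cancel]
    · rw [Finset.disjoint_right]
      simp only [Finset.mem_insert, Finset.mem_singleton]
      rintro _ (rfl | rfl) <;> assumption
    · intro e
      simp only [Finset.mem_insert, Finset.mem_singleton, Finset.mem_union]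
      rintro (rfl | rfl) <;> simp [h₁, h₂]
  have m : ∀ e, e ∈ H' ↔ (e ∈ H ∨ e = f₁ ∨ e = f₂) ∧ ¬(e = e₁ ∨ e = e₂) := by
    intro e
    simp only [← h, Finset.mem_sdiff, Finset.mem_union, Finset.mem_insert, Finset.mem_singleton]
  have a₁ : e₁ ∉ H' := by simp [m]
  have a₂ : e₂ ∉ H' := by simp [m]
  refine ⟨by grind, by grind, ?_, hcard.symm⟩
  rw [if_pos ⟨a₁, a₂⟩]
  ext e
  simp only [Finset.mem_sdiff, Finset.mem_union, Finset.mem_insert, Finset.mem_singleton, m]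
  grind

theorem hingeFlipAt_spec {H H' : PartiteHypergraph A B C} {e e' : Hyperedge A B C}
    (he : e ∈ H) (hne : H' ≠ H) (h : hingeFlipAt H e e' = H') :
    e' ∈ H' ∧ hingeFlipAt H' e' e = H ∧ H.card = H'.card := by
  unfold hingeFlipAt at h
  split_ifs at h with hif
  · exact absurd h.symm hne
  have hcard : H'.card = H.card := by
    rw [← h, Finset.card_sdiff_of_subset (by simp [he]),
      Finset.card_union_of_disjoint (by simpa using hif), Finset.card_singleton,
      Finset.card_singleton, Nat.add_sub_cancel]
  have m : ∀ g, g ∈ H' ↔ (g ∈ H ∨ g = e') ∧ g ≠ e := by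
    intro g
    simp only [← h, Finset.mem_sdiff, Finset.mem_union, Finset.mem_singleton, ne_eq]
  refine ⟨by grind, ?_, hcard.symm⟩
  rw [hingeFlipAt, if_pos (by simp [m])]
  ext g
  simp only [Finset.mem_sdiff, Finset.mem_union, Finset.mem_singleton, m]
  grind

theorem toggleAt_toggleAt (H : PartiteHypergraph A B C) (e : Hyperedge A B C) :
    toggleAt (toggleAt H e) e = H := by
  ext g
  by_cases h : e ∈ H <;> simp only [toggleAt, h] <;> grind

/-- For equal sizes the normalisations agree and the triples `(e₁, e₂, X)` are matched by exchanging
the vertices in `X`; for different sizes both probabilities are zero. -/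
theorem switchProposal_comm {H H' : PartiteHypergraph A B C} (hne : H' ≠ H) :
    switchProposal H H' = switchProposal H' H := by
  by_cases hcard : H.card = H'.card
  · simp only [switchProposal, drawOr_apply_of_ne _ _ hne, drawOr_apply_of_ne _ _ hne.symm, hcard,
      ← Finset.mul_sum, ← Finset.sum_product']
    congr 3
    refine sum_pure_apply_eq _ _ _ _ _ _ (fun p =>
      (replaceVertex p.2.2 p.1 p.2.1, replaceVertex p.2.2 p.2.1 p.1, p.2.2)) ?_ ?_ ?_
    · rintro ⟨e₁, e₂, X⟩
      simp only [replaceVertex_replaceVertex]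
    · rintro ⟨e₁, e₂, X⟩ hp h
      simp only [Finset.mem_product] at hp
      obtain ⟨h1, h2, h3, -⟩ := switchAt_spec hp.1 hp.2.1 hne h
      simp [h1, h2, h3]
    · rintro ⟨e₁, e₂, X⟩ hp h
      simp only [Finset.mem_product] at hp
      obtain ⟨h1, h2, h3, -⟩ := switchAt_spec hp.1 hp.2.1 hne.symm h
      simp [h1, h2, h3]
  · have aux : ∀ {G G' : PartiteHypergraph A B C}, G' ≠ G → G.card ≠ G'.card →
        switchProposal G G' = 0 := by
      intro G G' hG hc
      refine drawOr_apply_eq_zero hG fun e₁ h₁ => drawOr_apply_eq_zero hG fun e₂ h₂ =>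
        drawOr_apply_eq_zero hG fun X _ => PMF.pure_apply_of_ne _ _ fun h => ?_
      exact hc (switchAt_spec h₁ h₂ hG h.symm).2.2.2
    rw [aux hne hcard, aux hne.symm (Ne.symm hcard)]

/-- `get` and `put` read and replace the vertex in one class, so that one argument covers all three.
-/
theorem sum_hingeFlip_comm {γ : Type*} [Fintype γ] [DecidableEq γ]
    (get : Hyperedge A B C → γ) (put : Hyperedge A B C → γ → Hyperedge A B C)
    (put_get : ∀ e, put e (get e) = e) (get_put : ∀ e x, get (put e x) = x)
    (put_put : ∀ e x y, put (put e x) y = put e y) {H H' : PartiteHypergraph A B C}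
    (hne : H' ≠ H) :
    ∑ e ∈ H, drawOr (Finset.univ.filter fun x => x ≠ get e) H
        (fun x => PMF.pure (hingeFlipAt H e (put e x))) H' =
      ∑ e ∈ H', drawOr (Finset.univ.filter fun x => x ≠ get e) H'
        (fun x => PMF.pure (hingeFlipAt H' e (put e x))) H := by
  have aux : ∀ {G G' : PartiteHypergraph A B C}, G' ≠ G →
      ∑ e ∈ G, drawOr (Finset.univ.filter fun x => x ≠ get e) G
        (fun x => PMF.pure (hingeFlipAt G e (put e x))) G' =
      ((Fintype.card γ - 1 : ℕ) : ENNReal)⁻¹ *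
        ∑ p ∈ G ×ˢ Finset.univ, PMF.pure (hingeFlipAt G p.1 (put p.1 p.2)) G' := by
    intro G G' hG
    rw [Finset.sum_product, Finset.mul_sum]
    refine Finset.sum_congr rfl fun e he => ?_
    rw [drawOr_apply_of_ne _ _ hG, Finset.filter_ne', Finset.card_erase_of_mem (Finset.mem_univ _),
      Finset.card_univ]
    congr 1
    -- The excluded choice `x = get e` may be added back: it reproduces `e ∈ G`, so nothing moves
    -- and the term at `G' ≠ G` is zero.
    refine Finset.sum_erase _ ?_
    rw [put_get, hingeFlipAt, if_neg (not_not.mpr he), PMF.pure_apply_of_ne _ _ hG]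
  rw [aux hne, aux hne.symm]
  congr 1
  -- The reverse move takes the new hyperedge and restores its old vertex.
  refine sum_pure_apply_eq _ _ _ _ _ _ (fun p => (put p.1 p.2, get p.1)) ?_ ?_ ?_
  · rintro ⟨e, x⟩
    simp [put_put, put_get, get_put]
  · rintro ⟨e, x⟩ hp h
    obtain ⟨h1, h2, -⟩ := hingeFlipAt_spec (Finset.mem_product.mp hp).1 hne h
    simp [put_put, put_get, h1, h2]
  · rintro ⟨e, x⟩ hp h
    obtain ⟨h1, h2, -⟩ := hingeFlipAt_spec (Finset.mem_product.mp hp).1 hne.symm h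
    simp [put_put, put_get, h1, h2]

variable [Fintype A] [Fintype B] [Fintype C]

theorem hingeFlipProposal_comm {H H' : PartiteHypergraph A B C} (hne : H' ≠ H) :
    hingeFlipProposal H H' = hingeFlipProposal H' H := by
  by_cases hcard : H.card = H'.card
  · rw [hingeFlipProposal, hingeFlipProposal, drawOr_apply_of_ne _ _ hne,
      drawOr_apply_of_ne _ _ hne.symm, hcard]
    congr 1
    simp only [drawOr_apply_of_ne (Finset.univ : Finset VertexClass) _ hne,
      drawOr_apply_of_ne (Finset.univ : Finset VertexClass) _ hne.symm, VertexClass.sum_univ,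
      ← Finset.mul_sum, Finset.sum_add_distrib]
    congr 1
    congr 1
    · congr 1
      · exact sum_hingeFlip_comm (fun e => e.1) (fun e x => (x, e.2.1, e.2.2))
          (fun _ => rfl) (fun _ _ => rfl) (fun _ _ _ => rfl) hne
      · exact sum_hingeFlip_comm (fun e => e.2.1) (fun e x => (e.1, x, e.2.2))
          (fun _ => rfl) (fun _ _ => rfl) (fun _ _ _ => rfl) hne
    · exact sum_hingeFlip_comm (fun e => e.2.2) (fun e x => (e.1, e.2.1, x))
          (fun _ => rfl) (fun _ _ => rfl) (fun _ _ _ => rfl) hne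
  · have aux : ∀ {G G' : PartiteHypergraph A B C}, G' ≠ G → G.card ≠ G'.card →
        hingeFlipProposal G G' = 0 := by
      intro G G' hG hc
      refine drawOr_apply_eq_zero hG fun e he => drawOr_apply_eq_zero hG fun X _ => ?_
      cases X <;> exact drawOr_apply_eq_zero hG fun x _ => PMF.pure_apply_of_ne _ _ fun h =>
        hc (hingeFlipAt_spec he hG h.symm).2.2
    rw [aux hne hcard, aux hne.symm (Ne.symm hcard)]

theorem toggleProposal_comm {H H' : PartiteHypergraph A B C} (hne : H' ≠ H) :
    toggleProposal H H' = toggleProposal H' H := by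
  rw [toggleProposal, toggleProposal, drawOr_apply_of_ne _ _ hne, drawOr_apply_of_ne _ _ hne.symm]
  congr 1
  refine sum_pure_apply_eq _ _ _ _ _ _ id (fun _ => rfl) ?_ ?_ <;>
  · rintro e - rfl
    exact ⟨Finset.mem_univ _, toggleAt_toggleAt _ _⟩

theorem proposal_comm {H H' : PartiteHypergraph A B C} (hne : H' ≠ H) :
    proposal H H' = proposal H' H := by
  simp only [proposal, PMF.bind_apply]
  refine tsum_congr fun j => ?_
  congr 1
  fin_cases j
  · exact switchProposal_comm hne
  · exact hingeFlipProposal_comm hne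
  · exact toggleProposal_comm hne

end ProposalSymmetry

/-! ### Stationarity and convergence of Parallel Tempering -/

section ParallelTempering

variable {A B C : Type*} [Fintype A] [Fintype B] [Fintype C]
  [DecidableEq A] [DecidableEq B] [DecidableEq C]

theorem detailedBalance_metropolisStep (D : DegreeSequence A B C) (T : ℝ) :
    DetailedBalance (metropolisStep D T) fun H => ENNReal.ofReal (boltzmannWeight D T H) :=
  detailedBalance_metropolis proposal (boltzmannWeight D T) (boltzmannWeight_pos D T)
    fun _ _ => proposal_comm

variable {n : ℕ} (D : DegreeSequence A B C) (T : Fin (n + 1) → ℝ)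

/-- The unnormalized weight of the product distribution. -/
noncomputable def productWeight (s : Fin (n + 1) → PartiteHypergraph A B C) : ℝ :=
  ∏ i, boltzmannWeight D (T i) (s i)

theorem productWeight_pos (s : Fin (n + 1) → PartiteHypergraph A B C) :
    0 < productWeight D T s :=
  Finset.prod_pos fun i _ => boltzmannWeight_pos D (T i) (s i)

/-- All factors except those at the two exchanged coordinates cancel. This exhibits the exchange as
a Metropolis move for the product weight. -/
theorem swapRatio_eq (s : Fin (n + 1) → PartiteHypergraph A B C) (i : Fin n) :
    swapRatio D (T i.castSucc) (T i.succ) (s i.castSucc) (s i.succ) =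
      productWeight D T (s ∘ Equiv.swap i.castSucc i.succ) / productWeight D T s := by
  have hne : i.castSucc ≠ i.succ := i.castSucc_lt_succ.ne
  have split : ∀ s : Fin (n + 1) → PartiteHypergraph A B C, productWeight D T s =
      (boltzmannWeight D (T i.castSucc) (s i.castSucc) * boltzmannWeight D (T i.succ) (s i.succ)) *
        ∏ j ∈ (Finset.univ.erase i.castSucc).erase i.succ, boltzmannWeight D (T j) (s j) := by
    intro s
    rw [mul_assoc, Finset.mul_prod_erase _ (fun j => boltzmannWeight D (T j) (s j))
      (Finset.mem_erase.mpr ⟨hne.symm, Finset.mem_univ _⟩),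
      Finset.mul_prod_erase _ (fun j => boltzmannWeight D (T j) (s j)) (Finset.mem_univ _),
      productWeight]
  have hrest : ∏ j ∈ (Finset.univ.erase i.castSucc).erase i.succ,
      boltzmannWeight D (T j) ((s ∘ Equiv.swap i.castSucc i.succ) j) =
      ∏ j ∈ (Finset.univ.erase i.castSucc).erase i.succ, boltzmannWeight D (T j) (s j) := by
    refine Finset.prod_congr rfl fun j hj => ?_
    simp only [Finset.mem_erase] at hj
    rw [Function.comp_apply, Equiv.swap_apply_of_ne_of_ne hj.2.1 hj.1]
  have hpos : (∏ j ∈ (Finset.univ.erase i.castSucc).erase i.succ,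
      boltzmannWeight D (T j) (s j)) ≠ 0 :=
    (Finset.prod_pos fun j _ => boltzmannWeight_pos D (T j) (s j)).ne'
  rw [split, split s, hrest, mul_div_mul_right _ _ hpos, swapRatio]
  simp only [Function.comp_apply, Equiv.swap_apply_left, Equiv.swap_apply_right]
  rw [mul_comm (boltzmannWeight D (T i.succ) _)]

theorem detailedBalance_parallelTemperingStep :
    DetailedBalance (parallelTemperingStep D T)
      fun s => ENNReal.ofReal (productWeight D T s) := by
  unfold parallelTemperingStep
  refine detailedBalance_bind _ fun b => ?_
  cases b
  · simp only [Bool.false_eq_true, if_false, swapRatio_eq]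
    refine detailedBalance_drawOr _ fun i => ?_
    -- The proposal is deterministic, and symmetric because a transposition is an involution.
    have := detailedBalance_metropolis
      (fun s : Fin (n + 1) → PartiteHypergraph A B C =>
        PMF.pure (s ∘ Equiv.swap i.castSucc i.succ))
      (productWeight D T) (productWeight_pos D T) ?_
    · simpa only [PMF.pure_bind] using this
    · intro s s' _
      have : s' = s ∘ Equiv.swap i.castSucc i.succ ↔ s = s' ∘ Equiv.swap i.castSucc i.succ := by
        constructor <;> rintro rfl <;> ext1 j <;> simp
      simp only [PMF.pure_apply]
      by_cases h : s' = s ∘ Equiv.swap i.castSucc i.succ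
      · rw [if_pos h, if_pos (this.mp h)]
      · rw [if_neg h, if_neg (mt this.mpr h)]
  · simp only [if_true]
    refine detailedBalance_drawOr _ fun i => ?_
    have := detailedBalance_update
      (fun (j : Fin (n + 1)) H => ENNReal.ofReal (boltzmannWeight D (T j) H)) i
      (detailedBalance_metropolisStep D (T i))
    simpa only [productWeight, ENNReal.ofReal_prod_of_nonneg
      fun j _ => (boltzmannWeight_pos D (T j) _).le] using this

theorem boltzmannProduct_apply (s : Fin (n + 1) → PartiteHypergraph A B C) :
    boltzmannProduct D T s = ∏ i, boltzmann D (T i) (s i) := rfl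

theorem boltzmannProduct_eq (s : Fin (n + 1) → PartiteHypergraph A B C) :
    boltzmannProduct D T s =
      ENNReal.ofReal (∏ i, partitionFunction D (T i))⁻¹ * ENNReal.ofReal (productWeight D T s) := by
  rw [← ENNReal.ofReal_mul (inv_nonneg.mpr
    (Finset.prod_nonneg fun i _ => (partitionFunction_pos D (T i)).le)), mul_comm,
    ← div_eq_mul_inv, productWeight, ← Finset.prod_div_distrib,
    ENNReal.ofReal_prod_of_nonneg fun i _ =>
      (div_pos (boltzmannWeight_pos D (T i) _) (partitionFunction_pos D (T i))).le]
  rfl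

theorem boltzmannProduct_bind_step :
    (boltzmannProduct D T).bind (parallelTemperingStep D T) = boltzmannProduct D T := by
  have := (detailedBalance_parallelTemperingStep D T).const_mul
    (ENNReal.ofReal (∏ i, partitionFunction D (T i))⁻¹)
  simp only [← boltzmannProduct_eq] at this
  exact this.bind_eq

theorem acceptProb_ne_zero {r : ℝ} (hr : 0 < r) : acceptProb r ≠ 0 := by
  rw [acceptProb_eq]
  simpa using hr

theorem metropolisStep_erase_ne_zero (T : ℝ) {H : PartiteHypergraph A B C}
    {e : Hyperedge A B C} (he : e ∈ H) : metropolisStep D T H (H \ {e}) ≠ 0 := by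
  have hne : H \ {e} ≠ H := fun h => by
    rw [← h] at he
    simp at he
  rw [metropolisStep, bind_acceptOr_apply_of_ne _ _ hne]
  refine mul_ne_zero ?_ (acceptProb_ne_zero
    (div_pos (boltzmannWeight_pos D T _) (boltzmannWeight_pos D T _)))
  rw [proposal, ← PMF.mem_support_iff, PMF.mem_support_bind_iff]
  -- Branch `2` of the proposal is the toggle.
  refine ⟨2, by simp, drawOr_apply_ne_zero (Finset.mem_univ e) H ?_⟩
  rw [toggleAt, if_pos he, PMF.pure_apply_self]
  exact one_ne_zero

theorem parallelTemperingStep_erase_ne_zero (s : Fin (n + 1) → PartiteHypergraph A B C)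
    (i : Fin (n + 1)) {e : Hyperedge A B C} (he : e ∈ s i) :
    parallelTemperingStep D T s (Function.update s i (s i \ {e})) ≠ 0 := by
  rw [parallelTemperingStep, ← PMF.mem_support_iff, PMF.mem_support_bind_iff]
  refine ⟨true, by simp, drawOr_apply_ne_zero (Finset.mem_univ i) s ?_⟩
  rw [PMF.map_update_apply, Function.update_self, PMF.pure_apply_self, mul_one]
  exact metropolisStep_erase_ne_zero D (T i) he

/-- Exchanging equal coordinates changes nothing, so a constant tuple is held with positive
probability. -/
theorem parallelTemperingStep_const_ne_zero (H : PartiteHypergraph A B C) :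
    parallelTemperingStep D T (fun _ => H) (fun _ => H) ≠ 0 := by
  rw [parallelTemperingStep, ← PMF.mem_support_iff, PMF.mem_support_bind_iff]
  refine ⟨false, by simp, ?_⟩
  rw [PMF.mem_support_iff]
  simp only [Bool.false_eq_true, if_false]
  by_cases hs : (Finset.univ : Finset (Fin n)).Nonempty
  · obtain ⟨i, hi⟩ := hs
    refine drawOr_apply_ne_zero hi _ ?_
    rw [acceptOr, ← PMF.mem_support_iff, PMF.mem_support_map_iff]
    refine ⟨true, ?_, rfl⟩
    rw [PMF.mem_support_iff]
    refine acceptProb_ne_zero ?_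
    exact div_pos (mul_pos (boltzmannWeight_pos D _ _) (boltzmannWeight_pos D _ _))
      (mul_pos (boltzmannWeight_pos D _ _) (boltzmannWeight_pos D _ _))
  -- With a single coordinate there is no pair to exchange, and the default outcome is the current
  -- state.
  · simp [drawOr, hs]

theorem tendsto_tvDist_parallelTemperingLaw
    (μ : PMF (Fin (n + 1) → PartiteHypergraph A B C)) :
    Tendsto (fun t => tvDist (parallelTemperingLaw D T μ t) (boltzmannProduct D T))
      atTop (𝓝 0) := by
  -- Each erasing toggle lowers the total number of hyperedges; its maximum over all states serves
  -- as the common time.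
  let m : (Fin (n + 1) → PartiteHypergraph A B C) → ℕ := fun s => ∑ i, (s i).card
  refine tendsto_tvDist_iterate _ _ (boltzmannProduct_bind_step D T) (fun _ => ∅)
    (Finset.univ.sup m) (fun s => ?_) μ
  refine PMF.iterate_bind_ne_zero _ _ m (by simp [m])
    (parallelTemperingStep_const_ne_zero D T ∅) (fun s hs => ?_) _ s
    (Finset.le_sup (f := m) (Finset.mem_univ s))
  obtain ⟨i, hi⟩ := Function.ne_iff.mp hs
  obtain ⟨e, he⟩ := Finset.nonempty_iff_ne_empty.mpr hi
  refine ⟨_, Finset.sum_lt_sum (fun j _ => ?_) ⟨i, Finset.mem_univ i, ?_⟩,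
    parallelTemperingStep_erase_ne_zero D T s i he⟩
  · by_cases hj : j = i
    · subst hj
      simpa using Finset.card_le_card (Finset.sdiff_subset (s := s j) (t := {e}))
    · rw [Function.update_of_ne hj]
  · rw [Function.update_self, Finset.sdiff_singleton_eq_erase]
    exact Finset.card_erase_lt_of_mem he

/-- Both measures agree on singletons. Independence and the marginals are then those of a product
measure. -/
theorem toMeasure_boltzmannProduct :
    (boltzmannProduct D T).toMeasure = Measure.pi fun i => (boltzmann D (T i)).toMeasure := by
  refine Measure.ext_of_singleton fun s => ?_
  rw [PMF.toMeasure_apply_singleton _ _ (measurableSet_singleton s), Measure.pi_singleton,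
    boltzmannProduct_apply]
  exact Finset.prod_congr rfl fun i _ =>
    (PMF.toMeasure_apply_singleton _ _ (measurableSet_singleton _)).symm

theorem iIndepFun_boltzmannProduct :
    iIndepFun (fun (i : Fin (n + 1)) (s : Fin (n + 1) → PartiteHypergraph A B C) => s i)
      (boltzmannProduct D T).toMeasure := by
  rw [toMeasure_boltzmannProduct]
  exact iIndepFun_pi (X := fun _ H => H) fun _ => aemeasurable_id

theorem map_eval_boltzmannProduct (i : Fin (n + 1)) :
    (boltzmannProduct D T).map (fun s => s i) = boltzmann D (T i) := by
  apply PMF.toMeasure_injective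
  rw [← PMF.toMeasure_map _ _ (measurable_pi_apply i), toMeasure_boltzmannProduct]
  exact (measurePreserving_eval (fun i => (boltzmann D (T i)).toMeasure) i).map_eq

end ParallelTempering

theorem mainTheorem5 {A B C : Type*} [Fintype A] [Fintype B] [Fintype C]
    [DecidableEq A] [DecidableEq B] [DecidableEq C] (D : DegreeSequence A B C)
    (n : ℕ) (T : Fin (n + 1) → ℝ) (hpos : ∀ i, 0 < T i) (hmono : StrictMono T) :
    (∀ μ : PMF (Fin (n + 1) → PartiteHypergraph A B C),
      Tendsto (fun t => tvDist (parallelTemperingLaw D T μ t) (boltzmannProduct D T))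
        atTop (𝓝 0)) ∧
    iIndepFun (fun (i : Fin (n + 1)) (s : Fin (n + 1) → PartiteHypergraph A B C) => s i)
      (boltzmannProduct D T).toMeasure ∧
    ∀ i, (boltzmannProduct D T).map (fun s => s i) = boltzmann D (T i) := by
  exact ⟨tendsto_tvDist_parallelTemperingLaw D T, iIndepFun_boltzmannProduct D T,
    map_eval_boltzmannProduct D T⟩
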